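/- Work over $\mathbb C$, write $\mathbb P^2=\mathbb P^2_{\mathbb C}$, and for $k$ point pairs $(x_i,y_i)\in\mathbb P^2\times\mathbb P^2$ let $Z_k$ be the $k\times 9$ matrix with rows $x_i^\top\otimes y_i^\top$ (its rank does not depend on the chosen coordinate vectors). Points of $\mathbb P^2$ are in general position if at most two of them lie on a line and at most five on a conic. Point pairs $(x_i,y_i)$ are in general position if the $x_i$ are, the $y_i$ are, and no more than four of the pairs are related by a homography $Hx_i=y_i$. For points $p_1,\dots,p_5$, no three collinear, the planar cross-ratio around $p_5$ is $$(p_1,p_2;p_3,p_4;p_5)=\frac{[135]\,[245]}{[145]\,[235]},\qquad [ijl]=\det(p_i,p_j,p_l).$$ Let $(x_i,y_i)_{i=1}^5$ be in general position. Call condition $(\ast)$: for every permutation $\sigma$ of $\{1,\dots,5\}$, $$(x_{\sigma(1)},x_{\sigma(2)};x_{\sigma(3)},x_{\sigma(4)};x_{\sigma(5)})\neq(y_{\sigma(1)},y_{\sigma(2)};y_{\sigma(3)},y_{\sigma(4)};y_{\sigma(5)}).$$ 1. If $(\ast)$ holds, there is a unique pair $(x_6,y_6)\in\mathbb P^2\times\mathbb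 P^2$ different from the five pairs $(x_i,y_i)$ such that $Z_6$ is rank deficient, i.e. $\operatorname{rank} Z_6<6$. If $(\ast)$ fails, there is no such pair. 2. The sixth pair is a rational function of the first five: there are polynomials $P_1,P_2,P_3,Q_1,Q_2,Q_3$ over $\mathbb C$ in the $30$ homogeneous coordinates of five point pairs such that for all five pairs in general position with $(\ast)$, and all choices of homogeneous coordinates for them, the vectors of values $(P_1,P_2,P_3)$ and $(Q_1,Q_2,Q_3)$ are nonzero and are homogeneous coordinates of $x_6$ and $y_6$. 3. Assume $(\ast)$. There are homographies $A$, $B$ of $\mathbb P^2$ that send $x_1,\dots,x_4$, respectively $y_1,\dots,y_4$, to $(1,0,0)$, $(0,1,0)$, $(0,0,1)$, $(1,1,1)$. For any such $A$, $B$, if $(x_{51},x_{52},x_{53})$ and $(y_{51},y_{52},y_{53})$ are homogeneous coordinates of $Ax_5$ and $By_5$, then all denominators below are nonzero and $$Ax_6=\left(\frac{y_{53}-y_{52}}{y_{53}x_{52}-x_{53}y_{52}},\ \frac{y_{53}-y_{51}}{y_{53}x_{51}-x_{53}y_{51}},\ \frac{y_{51}-y_{52}}{y_{51}x_{52}-x_{51}y_{52}}\right),$$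 $$By_6=\left(\frac{x_{53}-x_{52}}{y_{53}x_{52}-x_{53}y_{52}},\ \frac{x_{53}-x_{51}}{y_{53}x_{51}-x_{53}y_{51}},\ \frac{x_{51}-x_{52}}{y_{51}x_{52}-x_{51}y_{52}}\right).$$ -/

import Mathlib

open scoped LinearAlgebra.Projectivization

noncomputable section

namespace SixthPoint

/-- Coordinate vectors: the space `ℂ³`. -/
abbrev Vec : Type := Fin 3 → ℂ

/-- The complex projective plane. -/
abbrev Plane : Type := ℙ ℂ Vec

/-- A homography of the plane, given by an invertible linear map of `ℂ³`. -/
abbrev Homography : Type := Vec ≃ₗ[ℂ] Vec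

/-- The action of a homography on the points of the plane. -/
def Homography.app (H : Homography) (p : Plane) : Plane :=
  p.map H.toLinearMap H.injective

/-- The `k × 9` matrix with rows `xᵢᵀ ⊗ yᵢᵀ`, built from coordinate vectors. -/
def rowMatrix {k : ℕ} (v w : Fin k → Vec) : Matrix (Fin k) (Fin 3 × Fin 3) ℂ :=
  Matrix.of fun i jl => v i jl.1 * w i jl.2

/-- The matrix `Z_k` of `k` point pairs. Other representatives of the points rescale the rows by
nonzero factors, so the rank of `Z_k` depends on the points only. -/
def Z {k : ℕ} (x y : Fin k → Plane) : Matrix (Fin k) (Fin 3 × Fin 3) ℂ :=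
  rowMatrix (fun i => (x i).rep) (fun i => (y i).rep)

/-- Points of the plane, listed by an index, are in general position: at most two of them lie on
a line and at most five of them lie on a conic. -/
structure InGeneralPosition {k : ℕ} (p : Fin k → Plane) : Prop where
  line : ∀ L : Submodule ℂ Vec, Module.finrank ℂ L = 2 →
    {i : Fin k | (p i).submodule ≤ L}.ncard ≤ 2
  conic : ∀ Q : QuadraticForm ℂ Vec, Q ≠ 0 → {i : Fin k | Q (p i).rep = 0}.ncard ≤ 5

/-- Point pairs are in general position: each of the two lists of points is in general position,
and no more than four pairs are related by one homography. -/
structure PairsInGeneralPosition {k : ℕ} (x y : Fin k → Plane) : Prop where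
  left : InGeneralPosition x
  right : InGeneralPosition y
  homography : ∀ H : Homography, {i : Fin k | H.app (x i) = y i}.ncard ≤ 4

/-- The bracket `[u v w]`: the determinant of the matrix with rows `u`, `v`, `w`. -/
def bracket (u v w : Vec) : ℂ := Matrix.det (Matrix.of ![u, v, w])

/-- The planar cross-ratio `(p₁, p₂; p₃, p₄; p₅)`, the cross-ratio around `p₅` (here `p 4`), of five
points. Each point occurs equally often in the numerator and in the denominator, so the choice of
representatives does not matter. The denominator is nonzero if no three of the points are
collinear. -/
def planarCrossRatio (p : Fin 5 → Plane) : ℂ :=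
  (bracket (p 0).rep (p 2).rep (p 4).rep * bracket (p 1).rep (p 3).rep (p 4).rep) /
    (bracket (p 0).rep (p 3).rep (p 4).rep * bracket (p 1).rep (p 2).rep (p 4).rep)

/-- No planar cross-ratio of the five points `x` equals the corresponding one of the five
points `y`, whichever of the five points it is taken around. -/
def CrossRatiosDiffer (x y : Fin 5 → Plane) : Prop :=
  ∀ σ : Equiv.Perm (Fin 5), planarCrossRatio (x ∘ σ) ≠ planarCrossRatio (y ∘ σ)

/-- The pair `p = (x₆, y₆)` is new, that is different from the five given pairs, and makes the
matrix `Z₆` rank deficient. -/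
def IsSixthPair (x y : Fin 5 → Plane) (p : Plane × Plane) : Prop :=
  (∀ i, p ≠ (x i, y i)) ∧
    (Z (Fin.snoc x p.1 : Fin 6 → Plane) (Fin.snoc y p.2 : Fin 6 → Plane)).rank < 6

/-- The standard frame `(1,0,0)`, `(0,1,0)`, `(0,0,1)`, `(1,1,1)`, in coordinates. -/
def frameVec : Fin 4 → Vec := ![![1, 0, 0], ![0, 1, 0], ![0, 0, 1], ![1, 1, 1]]

lemma frameVec_ne_zero (i : Fin 4) : frameVec i ≠ 0 := by
  intro h
  fin_cases i
  · simpa [frameVec] using congrFun h 0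
  · simpa [frameVec] using congrFun h 1
  · simpa [frameVec] using congrFun h 2
  · simpa [frameVec] using congrFun h 0

/-- The standard frame, as points of the plane. -/
def frame (i : Fin 4) : Plane := Projectivization.mk ℂ (frameVec i) (frameVec_ne_zero i)

/-- The homography `H` sends the first four of the five points to the standard frame. -/
def FixesFrame (H : Homography) (p : Fin 5 → Plane) : Prop :=
  ∀ i : Fin 4, H.app (p i.castSucc) = frame i

/-- The three denominators in the formula for the sixth pair, where `a` and `b` are the
coordinates of the fifth points. -/
def formulaDen (a b : Vec) : Vec :=
  ![b 2 * a 1 - a 2 * b 1, b 2 * a 0 - a 2 * b 0, b 0 * a 1 - a 0 * b 1]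

/-- The coordinates of `x₆` in terms of those of `x₅` and `y₅`. -/
def formulaX (a b : Vec) : Vec :=
  ![(b 2 - b 1) / formulaDen a b 0, (b 2 - b 0) / formulaDen a b 1,
    (b 0 - b 1) / formulaDen a b 2]

/-- The coordinates of `y₆` in terms of those of `x₅` and `y₅`. -/
def formulaY (a b : Vec) : Vec :=
  ![(a 2 - a 1) / formulaDen a b 0, (a 2 - a 0) / formulaDen a b 1,
    (a 0 - a 1) / formulaDen a b 2]

/-- Polynomials in the homogeneous coordinates of the five point pairs: `Sum.inl (i, j)` stands
for the `j`-th coordinate of `xᵢ` and `Sum.inr (i, j)` for the `j`-th coordinate of `yᵢ`. -/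
abbrev CoordPoly : Type := MvPolynomial (Fin 5 × Fin 3 ⊕ Fin 5 × Fin 3) ℂ

/-- The value of a polynomial at coordinate vectors of five point pairs. -/
def CoordPoly.evalAt (P : CoordPoly) (v w : Fin 5 → Vec) : ℂ :=
  MvPolynomial.eval (Sum.elim (fun ij => v ij.1 ij.2) (fun ij => w ij.1 ij.2)) P

end SixthPoint

end

noncomputable section

namespace SixthPoint

/-! Homographies on the two sides preserve linear dependence of the tensors `xᵢ ⊗ yᵢ`, so the first
four points of each list may be taken to be the standard frame, with `a` and `b` as fifth points.
Combinations of `eⱼ ⊗ eⱼ` fill the diagonal freely, and the five given tensors are independent.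
Hence `p ⊗ q` completes a dependent family exactly when `p j * q l = c + d * (a j * b l)` for all `j
≠ l` (`dependent_frameWith_iff`).

The six off-diagonal entries of a rank one tensor satisfy one cubic relation: the products along the
two 3-cycles agree. Substituting the ansatz, the cubes of `c` and of `d` cancel and `c * d * (c *
invS a b + d * invT a b) = 0` remains. If `c` or `d` vanishes, `p ⊗ q` is one of the given tensors.
Otherwise `c : d = invT a b : -invS a b`, and every entry `invT a b - invS a b * (a j * b l)` splits
into a difference of coordinates of `b`, one of coordinates of `a`, and a minor of `(a, b)`. The
ratios of these factors determine `p` and `q`; this is the formula (`eq_formula_of_offDiag`), and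
with it uniqueness.

The invariants and minors are numerators of differences of cross-ratios: `invT` around the fifth
point, `invS` around `(1,1,1)`, `formulaDen a b j` around `eⱼ`. Condition (∗) thus makes all of them
nonzero and the formula gives a sixth pair. Conversely, a sixth pair forces `invT a b ≠ 0`; as its
defining property is symmetric in the five pairs, permuting them gives every inequality in (∗). For
polynomiality, the frames are written by Cramer's rule and denominators are cleared. -/

/-- The first invariant of two points in frame coordinates; it vanishes exactly when the
cross-ratios around `(1,1,1)` agree. -/
def invS (a b : Vec) : ℂ :=
  a 0 * b 1 + a 1 * b 2 + a 2 * b 0 - a 1 * b 0 - a 2 * b 1 - a 0 * b 2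

/-- The second invariant of two points in frame coordinates; it vanishes exactly when the
cross-ratios around the fifth point agree. -/
def invT (a b : Vec) : ℂ :=
  a 0 * b 1 * a 1 * b 2 + a 0 * b 1 * a 2 * b 0 + a 1 * b 2 * a 2 * b 0 -
    a 1 * b 0 * a 2 * b 1 - a 1 * b 0 * a 0 * b 2 - a 2 * b 1 * a 0 * b 2

/-- A point in general position with respect to the standard frame. -/
structure GenericVec (a : Vec) : Prop where
  ne_zero : ∀ i, a i ≠ 0
  injective : Function.Injective a

lemma GenericVec.sub_ne_zero {a : Vec} (ha : GenericVec a) {i j : Fin 3} (h : i ≠ j) :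
    a i - a j ≠ 0 := _root_.sub_ne_zero.2 fun e => h (ha.injective e)

/-! ### Algebra in frame coordinates -/

section identities

variable (a b : Vec)

lemma invT_sub_01 : invT a b - invS a b * (a 0 * b 1) =
    (b 2 - b 1) * (a 2 - a 0) * formulaDen a b 2 := by
  simp [invS, invT, formulaDen]; ring

lemma invT_sub_10 : invT a b - invS a b * (a 1 * b 0) =
    (b 2 - b 0) * (a 2 - a 1) * formulaDen a b 2 := by
  simp [invS, invT, formulaDen]; ring

lemma invT_sub_02 : invT a b - invS a b * (a 0 * b 2) =
    (b 2 - b 1) * (a 0 - a 1) * formulaDen a b 1 := by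
  simp [invS, invT, formulaDen]; ring

lemma invT_sub_20 : invT a b - invS a b * (a 2 * b 0) =
    (b 0 - b 1) * (a 2 - a 1) * formulaDen a b 1 := by
  simp [invS, invT, formulaDen]; ring

lemma invT_sub_12 : invT a b - invS a b * (a 1 * b 2) =
    (b 2 - b 0) * (a 0 - a 1) * formulaDen a b 0 := by
  simp [invS, invT, formulaDen]; ring

lemma invT_sub_21 : invT a b - invS a b * (a 2 * b 1) =
    (b 0 - b 1) * (a 2 - a 0) * formulaDen a b 0 := by
  simp [invS, invT, formulaDen]; ring

end identities

/-- The standard frame, followed by a fifth vector. -/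
def frameWith (a : Vec) : Fin 5 → Vec :=
  ![![1, 0, 0], ![0, 1, 0], ![0, 0, 1], ![1, 1, 1], a]

/-- The entries of `formulaDen a b` are, up to sign, the 2×2 minors of `(a, b)`. Two of them share
an index `i`, and since `a i ≠ 0` their vanishing would give `b = (b i / a i) • a`. -/
lemma formulaDen_pair_ne_zero {a b : Vec} (ha : GenericVec a) (hab : ∀ k : ℂ, b ≠ k • a) :
    (formulaDen a b 2 = 0 → formulaDen a b 1 ≠ 0) ∧
    (formulaDen a b 2 = 0 → formulaDen a b 0 ≠ 0) ∧
    (formulaDen a b 1 = 0 → formulaDen a b 0 ≠ 0) := by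
  have h0 := ha.ne_zero 0
  have h1 := ha.ne_zero 1
  have h2 := ha.ne_zero 2
  simp only [formulaDen, Matrix.cons_val]
  refine ⟨fun e f => hab (b 0 / a 0) ?_, fun e f => hab (b 1 / a 1) ?_,
    fun e f => hab (b 2 / a 2) ?_⟩ <;>
  · ext i
    fin_cases i <;> simp only [Pi.smul_apply, smul_eq_mul, Fin.zero_eta, Fin.mk_one,
      Fin.reduceFinMk] <;> field_simp <;>
      first
        | ring1
        | linear_combination e
        | linear_combination f
        | linear_combination -e
        | linear_combination -f

/-- A rank one tensor that agrees off the diagonal with a combination of `(1,1,1) ⊗ (1,1,1)` and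
`a ⊗ b` is one of the five given tensors or the one given by the formula. -/
theorem eq_formula_of_offDiag {a b p q : Vec} {c d : ℂ} (ha : GenericVec a) (hb : GenericVec b)
    (hab : ∀ k : ℂ, b ≠ k • a) (hp : p ≠ 0) (hq : q ≠ 0)
    (h : ∀ j l, j ≠ l → p j * q l = c + d * (a j * b l))
    (hne : ∀ i, ¬((∃ k : ℂ, p = k • frameWith a i) ∧ ∃ k : ℂ, q = k • frameWith b i)) :
    invS a b ≠ 0 ∧ invT a b ≠ 0 ∧ (∀ j, formulaDen a b j ≠ 0) ∧
      (∃ k : ℂ, p = k • formulaX a b) ∧ ∃ k : ℂ, q = k • formulaY a b := by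
  have h01 := h 0 1 (by decide)
  have h10 := h 1 0 (by decide)
  have h02 := h 0 2 (by decide)
  have h20 := h 2 0 (by decide)
  have h12 := h 1 2 (by decide)
  have h21 := h 2 1 (by decide)
  have a0 := ha.ne_zero 0
  have a1 := ha.ne_zero 1
  have a2 := ha.ne_zero 2
  have b0 := hb.ne_zero 0
  have b1 := hb.ne_zero 1
  have b2 := hb.ne_zero 2
  have a01 := ha.sub_ne_zero (show (0 : Fin 3) ≠ 1 by decide)
  have a20 := ha.sub_ne_zero (show (2 : Fin 3) ≠ 0 by decide)
  have a21 := ha.sub_ne_zero (show (2 : Fin 3) ≠ 1 by decide)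
  have b01 := hb.sub_ne_zero (show (0 : Fin 3) ≠ 1 by decide)
  have b20 := hb.sub_ne_zero (show (2 : Fin 3) ≠ 0 by decide)
  have b21 := hb.sub_ne_zero (show (2 : Fin 3) ≠ 1 by decide)
  have hd := formulaDen_pair_ne_zero ha hab
  have hST : ¬ (invS a b = 0 ∧ invT a b = 0) := by
    rintro ⟨hS, hT⟩
    have e1 := invT_sub_01 a b
    have e2 := invT_sub_02 a b
    rw [hS, hT] at e1 e2
    simp only [zero_mul, sub_zero, zero_eq_mul, mul_eq_zero, b21, a20, a01, false_or] at e1 e2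
    exact hd.1 e1 e2
  by_cases hd0 : d = 0
  · subst hd0
    simp only [zero_mul, add_zero] at h01 h10 h02 h20 h12 h21
    by_cases hc0 : c = 0
    · subst hc0
      exfalso
      -- A diagonal tensor of rank one is a multiple of some `eⱼ ⊗ eⱼ`.
      have key : ∀ j, p j ≠ 0 → False := by
        intro j hj
        have hql : ∀ l, j ≠ l → q l = 0 := fun l hl => by simpa [hj] using h j l hl
        have hqj : q j ≠ 0 := by
          intro e
          exact hq (funext fun l => by
            rcases eq_or_ne j l with rfl | hl
            · exact e
            · exact hql l hl)
        have hpl : ∀ l, j ≠ l → p l = 0 := fun l hl => by simpa [hqj] using h l j hl.symm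
        refine hne (Fin.castLE (by decide) j) ⟨⟨p j, ?_⟩, ⟨q j, ?_⟩⟩
        · ext l
          fin_cases j <;> fin_cases l <;> simp [frameWith] <;> exact hpl _ (by decide)
        · ext l
          fin_cases j <;> fin_cases l <;> simp [frameWith] <;> exact hql _ (by decide)
      exact hp (funext fun j => by_contra (key j))
    · exfalso
      have p0 : p 0 ≠ 0 := left_ne_zero_of_mul (h01.trans_ne hc0)
      have p1 : p 1 ≠ 0 := left_ne_zero_of_mul (h10.trans_ne hc0)
      have p2 : p 2 ≠ 0 := left_ne_zero_of_mul (h20.trans_ne hc0)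
      have q0 : q 0 ≠ 0 := right_ne_zero_of_mul (h10.trans_ne hc0)
      have q1 : q 1 ≠ 0 := right_ne_zero_of_mul (h01.trans_ne hc0)
      have q2 : q 2 ≠ 0 := right_ne_zero_of_mul (h02.trans_ne hc0)
      -- All off-diagonal entries are equal and nonzero, so `p` and `q` are multiples of `(1,1,1)`.
      refine hne 3 ⟨⟨p 0, ?_⟩, ⟨q 0, ?_⟩⟩
      · have e1 : p 1 = p 0 := mul_right_cancel₀ q2 (h12.trans h02.symm)
        have e2 : p 2 = p 0 := mul_right_cancel₀ q1 (h21.trans h01.symm)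
        ext l; fin_cases l <;> simp [frameWith, e1, e2]
      · have e1 : q 1 = q 0 := mul_left_cancel₀ p2 (h21.trans h20.symm)
        have e2 : q 2 = q 0 := mul_left_cancel₀ p1 (h12.trans h10.symm)
        ext l; fin_cases l <;> simp [frameWith, e1, e2]
  by_cases hc0 : c = 0
  · subst hc0
    exfalso
    simp only [zero_add] at h01 h10 h02 h20 h12 h21
    have p0 : p 0 ≠ 0 := left_ne_zero_of_mul (h01.trans_ne (by positivity))
    have p1 : p 1 ≠ 0 := left_ne_zero_of_mul (h10.trans_ne (by positivity))
    have p2 : p 2 ≠ 0 := left_ne_zero_of_mul (h20.trans_ne (by positivity))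
    have q0 : q 0 ≠ 0 := right_ne_zero_of_mul (h10.trans_ne (by positivity))
    have q1 : q 1 ≠ 0 := right_ne_zero_of_mul (h01.trans_ne (by positivity))
    have q2 : q 2 ≠ 0 := right_ne_zero_of_mul (h02.trans_ne (by positivity))
    -- The off-diagonal entries are those of `d • a ⊗ b`, none of them zero; this already fixes the
    -- ratios of the coordinates of `p` and `q`.
    refine hne 4 ⟨⟨p 0 / a 0, ?_⟩, ⟨q 0 / b 0, ?_⟩⟩
    · have e1 : p 1 * a 0 = p 0 * a 1 := mul_right_cancel₀ q2 (by
        linear_combination a 0 * h12 - a 1 * h02)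
      have e2 : p 2 * a 0 = p 0 * a 2 := mul_right_cancel₀ q1 (by
        linear_combination a 0 * h21 - a 2 * h01)
      ext l; fin_cases l <;> simp [frameWith] <;> field_simp <;> assumption
    · have e1 : q 1 * b 0 = q 0 * b 1 := mul_left_cancel₀ p2 (by
        linear_combination b 0 * h21 - b 1 * h20)
      have e2 : q 2 * b 0 = q 0 * b 2 := mul_left_cancel₀ p1 (by
        linear_combination b 0 * h12 - b 2 * h10)
      ext l; fin_cases l <;> simp [frameWith] <;> field_simp <;> assumption
  -- The relation between the two 3-cycles, divided by `c * d`.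
  have cyc : c * invS a b + d * invT a b = 0 := by
    have e : (p 0 * q 1) * (p 1 * q 2) * (p 2 * q 0) =
        (p 1 * q 0) * (p 2 * q 1) * (p 0 * q 2) := by ring
    rw [h01, h12, h20, h10, h21, h02] at e
    refine mul_left_cancel₀ (mul_ne_zero hc0 hd0) ?_
    simp only [invS, invT]
    linear_combination e
  have hS : invS a b ≠ 0 := fun e => hST ⟨e, by simpa [e, hd0] using cyc⟩
  have hT : invT a b ≠ 0 := fun e => hST ⟨by simpa [e, hc0] using cyc, e⟩
  obtain ⟨k, hk⟩ : ∃ k, d = -k * invS a b := ⟨-d / invS a b, by field_simp⟩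
  have hk0 : k ≠ 0 := by rintro rfl; simp at hk; exact hd0 hk
  have hc : c = k * invT a b := mul_right_cancel₀ hS (by linear_combination cyc - invT a b * hk)
  have g (j l : Fin 3) (hjl : j ≠ l) : p j * q l = k * (invT a b - invS a b * (a j * b l)) := by
    rw [h j l hjl, hc, hk]; ring
  replace h01 := g 0 1 (by decide)
  replace h10 := g 1 0 (by decide)
  replace h02 := g 0 2 (by decide)
  replace h20 := g 2 0 (by decide)
  replace h12 := g 1 2 (by decide)
  replace h21 := g 2 1 (by decide)
  rw [invT_sub_01] at h01
  rw [invT_sub_10] at h10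
  rw [invT_sub_02] at h02
  rw [invT_sub_20] at h20
  rw [invT_sub_12] at h12
  rw [invT_sub_21] at h21
  clear g h cyc hST hc hk
  -- If one minor vanishes, the other two do not. The entries carrying those show that certain
  -- coordinates of `p` and `q` are nonzero, while an entry carrying the vanishing minor says that
  -- their product is zero.
  have D2 : formulaDen a b 2 ≠ 0 := by
    intro e
    have D1 := hd.1 e
    have D0 := hd.2.1 e
    have p0 : p 0 ≠ 0 := left_ne_zero_of_mul (h02.trans_ne (by positivity))
    have q1 : q 1 ≠ 0 := right_ne_zero_of_mul (h21.trans_ne (by positivity))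
    exact mul_ne_zero p0 q1 (by rw [h01, e]; ring)
  have D1 : formulaDen a b 1 ≠ 0 := by
    intro e
    have D0 := hd.2.2 e
    have p0 : p 0 ≠ 0 := left_ne_zero_of_mul (h01.trans_ne (by positivity))
    have q2 : q 2 ≠ 0 := right_ne_zero_of_mul (h12.trans_ne (by positivity))
    exact mul_ne_zero p0 q2 (by rw [h02, e]; ring)
  have D0 : formulaDen a b 0 ≠ 0 := by
    intro e
    have p1 : p 1 ≠ 0 := left_ne_zero_of_mul (h10.trans_ne (by positivity))
    have q2 : q 2 ≠ 0 := right_ne_zero_of_mul (h02.trans_ne (by positivity))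
    exact mul_ne_zero p1 q2 (by rw [h12, e]; ring)
  have p1 : p 1 ≠ 0 := left_ne_zero_of_mul (h10.trans_ne (by positivity))
  have p2 : p 2 ≠ 0 := left_ne_zero_of_mul (h21.trans_ne (by positivity))
  have q1 : q 1 ≠ 0 := right_ne_zero_of_mul (h21.trans_ne (by positivity))
  have q2 : q 2 ≠ 0 := right_ne_zero_of_mul (h02.trans_ne (by positivity))
  -- The scalars are `p 0 / formulaX a b 0` and `q 0 / formulaY a b 0`.
  refine ⟨hS, hT, fun j => by fin_cases j <;> assumption,
    ⟨p 0 * formulaDen a b 0 / (b 2 - b 1), ?_⟩, ⟨q 0 * formulaDen a b 0 / (a 2 - a 1), ?_⟩⟩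
  · have e1 : p 1 * ((b 2 - b 1) * formulaDen a b 1) =
        p 0 * (formulaDen a b 0 * (b 2 - b 0)) :=
      mul_right_cancel₀ q2 (by
        linear_combination ((b 2 - b 1) * formulaDen a b 1) * h12 -
          (formulaDen a b 0 * (b 2 - b 0)) * h02)
    have e2 : p 2 * ((b 2 - b 1) * formulaDen a b 2) =
        p 0 * (formulaDen a b 0 * (b 0 - b 1)) :=
      mul_right_cancel₀ q1 (by
        linear_combination ((b 2 - b 1) * formulaDen a b 2) * h21 -
          (formulaDen a b 0 * (b 0 - b 1)) * h01)
    ext l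
    fin_cases l <;> simp only [formulaX, Pi.smul_apply, smul_eq_mul, Fin.zero_eta, Fin.mk_one,
      Fin.reduceFinMk, Matrix.cons_val] <;> field_simp <;>
      first | linear_combination e1 | linear_combination e2
  · have e1 : q 1 * ((a 2 - a 1) * formulaDen a b 1) =
        q 0 * (formulaDen a b 0 * (a 2 - a 0)) :=
      mul_left_cancel₀ p2 (by
        linear_combination ((a 2 - a 1) * formulaDen a b 1) * h21 -
          (formulaDen a b 0 * (a 2 - a 0)) * h20)
    have e2 : q 2 * ((a 2 - a 1) * formulaDen a b 2) =
        q 0 * (formulaDen a b 0 * (a 0 - a 1)) :=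
      mul_left_cancel₀ p1 (by
        linear_combination ((a 2 - a 1) * formulaDen a b 2) * h12 -
          (formulaDen a b 0 * (a 0 - a 1)) * h10)
    ext l
    fin_cases l <;> simp only [formulaY, Pi.smul_apply, smul_eq_mul, Fin.zero_eta, Fin.mk_one,
      Fin.reduceFinMk, Matrix.cons_val] <;> field_simp <;>
      first | linear_combination e1 | linear_combination e2

lemma formulaX_mul_formulaY {a b : Vec} (hD : ∀ j, formulaDen a b j ≠ 0) {j l : Fin 3}
    (hjl : j ≠ l) : formulaX a b j * formulaY a b l *
      (formulaDen a b 0 * formulaDen a b 1 * formulaDen a b 2) =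
        invT a b - invS a b * (a j * b l) := by
  have D0 := hD 0
  have D1 := hD 1
  have D2 := hD 2
  fin_cases j <;> fin_cases l <;> simp only [Fin.zero_eta, Fin.mk_one, Fin.reduceFinMk, ne_eq,
    not_true_eq_false] at hjl ⊢ <;>
    simp only [invT_sub_01, invT_sub_10, invT_sub_02, invT_sub_20, invT_sub_12, invT_sub_21] <;>
    simp only [formulaX, formulaY, Matrix.cons_val] <;> field_simp

lemma formulaX_apply_ne_zero {a b : Vec} (hb : GenericVec b) (hD : ∀ j, formulaDen a b j ≠ 0)
    (j : Fin 3) : formulaX a b j ≠ 0 := by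
  fin_cases j
  · exact div_ne_zero (hb.sub_ne_zero (by decide)) (hD 0)
  · exact div_ne_zero (hb.sub_ne_zero (by decide)) (hD 1)
  · exact div_ne_zero (hb.sub_ne_zero (by decide)) (hD 2)

lemma formulaY_apply_ne_zero {a b : Vec} (ha : GenericVec a) (hD : ∀ j, formulaDen a b j ≠ 0)
    (j : Fin 3) : formulaY a b j ≠ 0 := by
  fin_cases j
  · exact div_ne_zero (ha.sub_ne_zero (by decide)) (hD 0)
  · exact div_ne_zero (ha.sub_ne_zero (by decide)) (hD 1)
  · exact div_ne_zero (ha.sub_ne_zero (by decide)) (hD 2)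

/-- The tensor given by the formula is none of the five given ones. -/
theorem formula_not_proportional {a b : Vec} (ha : GenericVec a) (hb : GenericVec b)
    (hD : ∀ j, formulaDen a b j ≠ 0) (hS : invS a b ≠ 0) (hT : invT a b ≠ 0) (i : Fin 5) :
    ¬((∃ k : ℂ, formulaX a b = k • frameWith a i) ∧
      ∃ k : ℂ, formulaY a b = k • frameWith b i) := by
  rintro ⟨⟨k, hk⟩, ⟨m, hm⟩⟩
  have hX := formulaX_apply_ne_zero hb hD
  have h01 := formulaX_mul_formulaY hD (show (0 : Fin 3) ≠ 1 by decide)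
  have h02 := formulaX_mul_formulaY hD (show (0 : Fin 3) ≠ 2 by decide)
  have b21 := hb.sub_ne_zero (show (2 : Fin 3) ≠ 1 by decide)
  have a0 := ha.ne_zero 0
  generalize formulaDen a b 0 * formulaDen a b 1 * formulaDen a b 2 = D at h01 h02
  fin_cases i
  · exact hX 1 (by simp [hk, frameWith])
  · exact hX 0 (by simp [hk, frameWith])
  · exact hX 0 (by simp [hk, frameWith])
  -- Comparing the entries 01 and 02: a tensor constant off the diagonal forces `invS a b = 0`, and
  -- in the next case a multiple of `a ⊗ b` forces `invT a b = 0`.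
  · simp [hk, hm, frameWith] at h01 h02
    refine mul_ne_zero (mul_ne_zero hS a0) b21 ?_
    linear_combination h02 - h01
  · simp [hk, hm, frameWith] at h01 h02
    have e : k * m * D + invS a b = 0 := mul_left_cancel₀ (mul_ne_zero a0 b21) (by
      linear_combination h02 - h01)
    exact hT (by linear_combination a 0 * b 1 * e - h01)

/-! ### Homographies in coordinates -/

/-- The homography `H` sends the point `p` to the point with homogeneous coordinates `v`. -/
def Homography.Sends (H : Homography) (p : Plane) (v : Vec) : Prop :=
  ∃ s : ℂ, s ≠ 0 ∧ v = s • H p.rep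

namespace Homography

variable {H : Homography} {p q : Plane} {v : Vec}

lemma app_mk (H : Homography) (v : Vec) (hv : v ≠ 0) :
    H.app (Projectivization.mk ℂ v hv) =
      Projectivization.mk ℂ (H v) (H.map_ne_zero_iff.2 hv) := rfl

lemma app_injective (H : Homography) : Function.Injective H.app :=
  Projectivization.map_injective _ H.injective

lemma Sends.ne_zero (h : H.Sends p v) : v ≠ 0 := by
  obtain ⟨s, hs, rfl⟩ := h
  exact smul_ne_zero hs (H.map_ne_zero_iff.2 p.rep_nonzero)

lemma sends_iff (hv : v ≠ 0) : H.Sends p v ↔ H.app p = Projectivization.mk ℂ v hv := by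
  conv_rhs => rw [← p.mk_rep, app_mk, eq_comm, Projectivization.mk_eq_mk_iff']
  constructor
  · rintro ⟨s, hs, rfl⟩
    exact ⟨s, rfl⟩
  · rintro ⟨s, hs⟩
    refine ⟨s, ?_, hs.symm⟩
    rintro rfl
    exact hv (by simpa using hs.symm)

lemma Sends.unique (hp : H.Sends p v) (hq : H.Sends q v) : p = q :=
  H.app_injective (((sends_iff hp.ne_zero).1 hp).trans ((sends_iff hp.ne_zero).1 hq).symm)

lemma Sends.of_smul {k : ℂ} {u : Vec} (hp : H.Sends p u) (h : u = k • v) : H.Sends p v := by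
  have hk : k ≠ 0 := by rintro rfl; exact hp.ne_zero (by simpa using h)
  obtain ⟨s, hs, rfl⟩ := hp
  refine ⟨k⁻¹ * s, by positivity, ?_⟩
  rw [mul_smul, h, inv_smul_smul₀ hk]

lemma exists_sends (H : Homography) (hv : v ≠ 0) : ∃ p, H.Sends p v := by
  have h : H.symm v ≠ 0 := H.symm.map_ne_zero_iff.2 hv
  refine ⟨Projectivization.mk ℂ _ h, (sends_iff hv).2 ?_⟩
  rw [app_mk]
  simp

lemma sends_rep (H : Homography) (p : Plane) : H.Sends p (H p.rep) :=
  ⟨1, one_ne_zero, by simp⟩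

lemma symm_sends_mk {F : Homography} {u : Vec} (hv : v ≠ 0) (s : ℂ) (hu : u ≠ 0)
    (h : F u = s • v) : Sends F.symm (Projectivization.mk ℂ v hv) u := by
  rw [sends_iff hu, app_mk, Projectivization.mk_eq_mk_iff']
  have hs : s ≠ 0 := by
    rintro rfl
    exact hu (F.map_eq_zero_iff.1 (by simpa using h))
  refine ⟨s⁻¹, ?_⟩
  rw [← F.symm_apply_apply u, h, map_smul, inv_smul_smul₀ hs]

lemma Sends.eq_iff {u : Vec} (hp : H.Sends p u) (hq : H.Sends q v) :
    p = q ↔ ∃ k : ℂ, u = k • v := by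
  rw [← H.app_injective.eq_iff, (sends_iff hp.ne_zero).1 hp, (sends_iff hq.ne_zero).1 hq,
    Projectivization.mk_eq_mk_iff']
  simp only [eq_comm]

end Homography

/-! ### Dependence of rank one tensors -/

/-- The tensors `vᵢ ⊗ wᵢ` are linearly dependent. -/
def Dependent {k : ℕ} (v w : Fin k → Vec) : Prop :=
  ∃ g : Fin k → ℂ, (∑ i, g i • Matrix.vecMulVec (v i) (w i)) = 0 ∧ ∃ i, g i ≠ 0

lemma rank_rowMatrix_lt {k : ℕ} (v w : Fin k → Vec) :
    (rowMatrix v w).rank < k ↔ Dependent v w := by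
  have h : (rowMatrix v w).rank < k ↔ ¬ LinearIndependent ℂ (rowMatrix v w).row := by
    have hle := (rowMatrix v w).rank_le_card_height
    rw [Fintype.card_fin] at hle
    rw [linearIndependent_iff_card_eq_finrank_span, Fintype.card_fin, Set.finrank]
    rw [Matrix.rank_eq_finrank_span_row] at hle ⊢
    omega
  rw [h, Fintype.not_linearIndependent_iff, Dependent]
  refine exists_congr fun g => and_congr_left fun _ => ?_
  constructor
  · intro e
    ext j l
    simpa [rowMatrix, Matrix.sum_apply, Matrix.vecMulVec_apply] using congrFun e (j, l)
  · intro e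
    ext ⟨j, l⟩
    simpa [rowMatrix, Matrix.sum_apply, Matrix.vecMulVec_apply] using congrFun (congrFun e j) l

/-- The pair `(A, B)` acts on tensors linearly by `M ↦ A * M * Bᵀ`; the rescalings are absorbed in
the coefficients. -/
lemma Dependent.map {k : ℕ} {v w v' w' : Fin k → Vec} (A B : Homography) (h : Dependent v w)
    (hv : ∀ i, ∃ s : ℂ, s ≠ 0 ∧ v' i = s • A (v i))
    (hw : ∀ i, ∃ s : ℂ, s ≠ 0 ∧ w' i = s • B (w i)) : Dependent v' w' := by
  obtain ⟨g, hg, i, hi⟩ := h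
  choose s hs hv using hv
  choose t ht hw using hw
  refine ⟨fun i => g i / (s i * t i), ?_, i, div_ne_zero hi (mul_ne_zero (hs i) (ht i))⟩
  have e : ∀ i, (g i / (s i * t i)) • Matrix.vecMulVec (v' i) (w' i) =
      LinearMap.toMatrix' A.toLinearMap * (g i • Matrix.vecMulVec (v i) (w i)) *
        (LinearMap.toMatrix' B.toLinearMap).transpose := by
    intro i
    rw [hv, hw, Matrix.mul_smul, Matrix.smul_mul, Matrix.mul_vecMulVec, Matrix.vecMulVec_mul,
      Matrix.vecMul_transpose, LinearMap.toMatrix'_mulVec, LinearMap.toMatrix'_mulVec]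
    ext j l
    have := hs i
    have := ht i
    simp [Matrix.vecMulVec_apply]
    field_simp
  simp_rw [e]
  rw [← Finset.sum_mul, ← Finset.mul_sum, hg]
  simp

lemma isSixthPair_iff {x y : Fin 5 → Plane} {p : Plane × Plane} {A B : Homography}
    {v w : Fin 5 → Vec} {u z : Vec} (hv : ∀ i, A.Sends (x i) (v i))
    (hw : ∀ i, B.Sends (y i) (w i)) (hu : A.Sends p.1 u) (hz : B.Sends p.2 z) :
    IsSixthPair x y p ↔ (∀ i, ¬((∃ k : ℂ, u = k • v i) ∧ ∃ k : ℂ, z = k • w i)) ∧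
      Dependent (Fin.snoc v u : Fin 6 → Vec) (Fin.snoc w z : Fin 6 → Vec) := by
  refine and_congr (forall_congr' fun i => not_congr ?_) ?_
  · rw [Prod.ext_iff, hu.eq_iff (hv i), hz.eq_iff (hw i)]
  · have hv' : ∀ i, A.Sends ((Fin.snoc x p.1 : Fin 6 → Plane) i)
        ((Fin.snoc v u : Fin 6 → Vec) i) := by
      intro i
      induction i using Fin.lastCases with
      | last => simpa only [Fin.snoc_last] using hu
      | cast i => simpa only [Fin.snoc_castSucc] using hv i
    have hw' : ∀ i, B.Sends ((Fin.snoc y p.2 : Fin 6 → Plane) i)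
        ((Fin.snoc w z : Fin 6 → Vec) i) := by
      intro i
      induction i using Fin.lastCases with
      | last => simpa only [Fin.snoc_last] using hz
      | cast i => simpa only [Fin.snoc_castSucc] using hw i
    rw [Z, rank_rowMatrix_lt]
    refine ⟨fun h => h.map A B hv' hw', fun h => h.map A.symm B.symm ?_ ?_⟩
    · intro i
      obtain ⟨s, hs, e⟩ := hv' i
      exact ⟨s⁻¹, inv_ne_zero hs, by rw [e, map_smul, A.symm_apply_apply, inv_smul_smul₀ hs]⟩
    · intro i
      obtain ⟨s, hs, e⟩ := hw' i
      exact ⟨s⁻¹, inv_ne_zero hs, by rw [e, map_smul, B.symm_apply_apply, inv_smul_smul₀ hs]⟩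

lemma dependent_frameWith_iff {a b : Vec} (ha : GenericVec a) (hb : GenericVec b) (p q : Vec) :
    Dependent (Fin.snoc (frameWith a) p : Fin 6 → Vec) (Fin.snoc (frameWith b) q : Fin 6 → Vec) ↔
      ∃ c d : ℂ, ∀ j l, j ≠ l → p j * q l = c + d * (a j * b l) := by
  constructor
  · rintro ⟨g, hg, hne⟩
    have h : ∀ j l, _ := fun j l => congrFun (congrFun hg j) l
    simp only [Fin.sum_univ_castSucc (n := 5), Fin.snoc_castSucc, Fin.snoc_last,
      Fin.sum_univ_five, Matrix.add_apply, Matrix.smul_apply, Matrix.vecMulVec_apply] at h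
    -- The coefficient of the sixth tensor cannot vanish, because the first five are independent:
    -- entries 01 and 02 kill `g 4` and then `g 3`, and the diagonal kills the rest.
    by_cases g5 : g 5 = 0
    · exfalso
      have h01 := h 0 1
      have h02 := h 0 2
      have h00 := h 0 0
      have h11 := h 1 1
      have h22 := h 2 2
      simp [frameWith, g5] at h01 h02 h00 h11 h22
      have g4 : g 4 = 0 := mul_right_cancel₀
        (mul_ne_zero (ha.ne_zero 0) (hb.sub_ne_zero (show (2 : Fin 3) ≠ 1 by decide))) (by
          linear_combination h02 - h01)
      rw [g4] at h01 h00 h11 h22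
      have g3 : g 3 = 0 := by linear_combination h01
      simp [g3] at h00 h11 h22
      obtain ⟨i, hi⟩ := hne
      fin_cases i
      exacts [hi h00, hi h11, hi h22, hi g3, hi g4, hi g5]
    · refine ⟨-g 3 / g 5, -g 4 / g 5, fun j l hjl => ?_⟩
      have := h j l
      field_simp
      fin_cases j <;> fin_cases l <;> simp [frameWith] at hjl this ⊢ <;>
        linear_combination this
  · rintro ⟨c, d, h⟩
    -- The diagonal discrepancy, which the tensors `eⱼ ⊗ eⱼ` correct.
    let r : Fin 3 → ℂ := fun j => c + d * (a j * b j) - p j * q j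
    refine ⟨![r 0, r 1, r 2, -c, -d, 1], ?_, 5, by simp⟩
    ext j l
    simp only [Fin.sum_univ_castSucc (n := 5), Fin.snoc_castSucc, Fin.snoc_last,
      Fin.sum_univ_five, Matrix.add_apply, Matrix.smul_apply, Matrix.vecMulVec_apply]
    have := h j l
    fin_cases j <;> fin_cases l <;> simp [frameWith, r] at this ⊢ <;>
      first | ring1 | linear_combination this

/-! ### Brackets and cross-ratios -/

lemma bracket_eq (u v w : Vec) : bracket u v w =
    u 0 * v 1 * w 2 - u 0 * v 2 * w 1 - u 1 * v 0 * w 2 + u 1 * v 2 * w 0 +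
      u 2 * v 0 * w 1 - u 2 * v 1 * w 0 := by
  simp [bracket, Matrix.det_fin_three]

lemma bracket_smul (r s t : ℂ) (u v w : Vec) :
    bracket (r • u) (s • v) (t • w) = r * s * t * bracket u v w := by
  simp only [bracket_eq, Pi.smul_apply, smul_eq_mul]
  ring

lemma bracket_map (H : Homography) (u v w : Vec) :
    bracket (H u) (H v) (H w) = LinearMap.det H.toLinearMap * bracket u v w := by
  have hH (z : Vec) (j : Fin 3) : H z j =
      z 0 * LinearMap.toMatrix' H.toLinearMap j 0 + z 1 * LinearMap.toMatrix' H.toLinearMap j 1 +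
        z 2 * LinearMap.toMatrix' H.toLinearMap j 2 := by
    conv_lhs => rw [← LinearEquiv.coe_coe, ← LinearMap.toMatrix'_mulVec]
    simp only [Matrix.mulVec, dotProduct, mul_comm, Fin.sum_univ_three]
  rw [← LinearMap.det_toMatrix']
  generalize LinearMap.toMatrix' H.toLinearMap = N at hH
  simp only [bracket_eq, hH, Matrix.det_fin_three]
  ring

/-- The planar cross-ratio of five coordinate vectors. -/
def vecCrossRatio (v : Fin 5 → Vec) : ℂ :=
  (bracket (v 0) (v 2) (v 4) * bracket (v 1) (v 3) (v 4)) /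
    (bracket (v 0) (v 3) (v 4) * bracket (v 1) (v 2) (v 4))

lemma planarCrossRatio_eq {x : Fin 5 → Plane} {H : Homography} {v : Fin 5 → Vec}
    (h : ∀ i, H.Sends (x i) (v i)) : planarCrossRatio x = vecCrossRatio v := by
  choose s hs hv using h
  have hd : LinearMap.det H.toLinearMap ≠ 0 := H.isUnit_det'.ne_zero
  -- The common factor of numerator and denominator: each has two brackets, in which the point `4`
  -- occurs twice and every other point once.
  have hk : LinearMap.det H.toLinearMap ^ 2 * (s 0 * s 1 * s 2 * s 3 * s 4 ^ 2) ≠ 0 := by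
    have h0 := hs 0
    have h1 := hs 1
    have h2 := hs 2
    have h3 := hs 3
    have h4 := hs 4
    positivity
  rw [vecCrossRatio, planarCrossRatio, ← mul_div_mul_right _ _ hk]
  simp only [hv, bracket_smul, bracket_map]
  congr 1 <;> ring

/-- A kernel vector `n` of the matrix of representatives would give a line `u ⬝ᵥ n = 0` through
three of the points. -/
lemma InGeneralPosition.bracket_ne_zero {x : Fin 5 → Plane} (hx : InGeneralPosition x)
    {H : Homography} {v : Fin 5 → Vec} (h : ∀ i, H.Sends (x i) (v i)) {i j k : Fin 5}
    (hij : i ≠ j) (hik : i ≠ k) (hjk : j ≠ k) : bracket (v i) (v j) (v k) ≠ 0 := by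
  choose s hs hv using h
  rw [hv, hv, hv, bracket_smul, bracket_map]
  refine mul_ne_zero (mul_ne_zero (mul_ne_zero (hs i) (hs j)) (hs k))
    (mul_ne_zero H.isUnit_det'.ne_zero fun e => ?_)
  obtain ⟨n, hn, hz⟩ := Matrix.exists_mulVec_eq_zero_iff.2 e
  let f : Module.Dual ℂ Vec := (dotProductBilin ℂ ℂ).flip n
  have hf : ∀ u, f u = u ⬝ᵥ n := fun u => rfl
  have hf0 : f ≠ 0 := by
    intro h0
    refine hn (funext fun m => ?_)
    have := hf (Pi.single m 1)
    rw [h0] at this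
    simpa using this.symm
  have hrank : Module.finrank ℂ (LinearMap.ker f) = 2 := by
    have := Module.Dual.finrank_ker_add_one_of_ne_zero hf0
    simp at this
    omega
  have hmem : ∀ m, f (x m).rep = 0 → (x m).submodule ≤ LinearMap.ker f := by
    intro m hm
    rw [Projectivization.submodule_eq, Submodule.span_singleton_le_iff_mem]
    exact hm
  have hsub : (({i, j, k} : Finset (Fin 5)) : Set (Fin 5)) ⊆
      {m | (x m).submodule ≤ LinearMap.ker f} := by
    intro m hm
    simp only [Finset.coe_insert, Finset.coe_singleton, Set.mem_insert_iff,
      Set.mem_singleton_iff] at hm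
    rcases hm with rfl | rfl | rfl
    · exact hmem _ (congrFun hz 0)
    · exact hmem _ (congrFun hz 1)
    · exact hmem _ (congrFun hz 2)
  have := (Set.ncard_le_ncard hsub (Set.toFinite _)).trans (hx.line _ hrank)
  rw [Set.ncard_coe_finset, Finset.card_eq_three.2 ⟨i, j, k, hij, hik, hjk, rfl⟩] at this
  omega

/-- Brackets of `a` with two basis vectors are its coordinates up to sign; with one basis vector and
`(1,1,1)` they are differences of coordinates. -/
lemma InGeneralPosition.genericVec {x : Fin 5 → Plane} (hx : InGeneralPosition x)
    {H : Homography} {a : Vec} (h : ∀ i, H.Sends (x i) (frameWith a i)) : GenericVec a := by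
  have k := fun i j k => hx.bracket_ne_zero h (i := i) (j := j) (k := k)
  have h12 := k 1 2 4 (by decide) (by decide) (by decide)
  have h02 := k 0 2 4 (by decide) (by decide) (by decide)
  have h01 := k 0 1 4 (by decide) (by decide) (by decide)
  have h03 := k 0 3 4 (by decide) (by decide) (by decide)
  have h13 := k 1 3 4 (by decide) (by decide) (by decide)
  have h23 := k 2 3 4 (by decide) (by decide) (by decide)
  simp [bracket_eq, frameWith] at h12 h02 h01 h03 h13 h23
  constructor
  · intro i
    fin_cases i <;> assumption
  · intro i j hij
    fin_cases i <;> fin_cases j <;> simp at hij ⊢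
    · exact h23 (by linear_combination -hij)
    · exact h13 (by linear_combination hij)
    · exact h23 (by linear_combination hij)
    · exact h03 (by linear_combination -hij)
    · exact h13 (by linear_combination -hij)
    · exact h03 (by linear_combination hij)

open scoped Matrix

lemma planarCrossRatio_comp_eq_iff {x y : Fin 5 → Plane} (hx : InGeneralPosition x)
    (hy : InGeneralPosition y) {A B : Homography} {v w : Fin 5 → Vec}
    (hv : ∀ i, A.Sends (x i) (v i)) (hw : ∀ i, B.Sends (y i) (w i)) (σ : Equiv.Perm (Fin 5)) :
    planarCrossRatio (x ∘ σ) = planarCrossRatio (y ∘ σ) ↔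
      bracket (v (σ 0)) (v (σ 2)) (v (σ 4)) * bracket (v (σ 1)) (v (σ 3)) (v (σ 4)) *
        (bracket (w (σ 0)) (w (σ 3)) (w (σ 4)) * bracket (w (σ 1)) (w (σ 2)) (w (σ 4))) =
      bracket (w (σ 0)) (w (σ 2)) (w (σ 4)) * bracket (w (σ 1)) (w (σ 3)) (w (σ 4)) *
        (bracket (v (σ 0)) (v (σ 3)) (v (σ 4)) * bracket (v (σ 1)) (v (σ 2)) (v (σ 4))) := by
  rw [planarCrossRatio_eq (x := x ∘ σ) (v := v ∘ σ) fun i => hv (σ i),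
    planarCrossRatio_eq (x := y ∘ σ) (v := w ∘ σ) fun i => hw (σ i), vecCrossRatio, vecCrossRatio,
    div_eq_div_iff]
  · rfl
  · refine mul_ne_zero (hx.bracket_ne_zero hv ?_ ?_ ?_) (hx.bracket_ne_zero hv ?_ ?_ ?_) <;>
      exact σ.injective.ne (by decide)
  · refine mul_ne_zero (hy.bracket_ne_zero hw ?_ ?_ ?_) (hy.bracket_ne_zero hw ?_ ?_ ?_) <;>
      exact σ.injective.ne (by decide)

/-! ### Pairs moved to the standard frame -/

section normalized

variable {x y : Fin 5 → Plane} {A B : Homography} {a b : Vec}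

/-- Each quantity comes from one permutation, chosen for the point it puts at the centre: `swap 3 4`
for `invS`, the identity for `invT`, `swap j 4` for `formulaDen a b j`. -/
lemma CrossRatiosDiffer.invariants_ne_zero (h : CrossRatiosDiffer x y)
    (hx : InGeneralPosition x) (hy : InGeneralPosition y)
    (hA : ∀ i, A.Sends (x i) (frameWith a i)) (hB : ∀ i, B.Sends (y i) (frameWith b i)) :
    invS a b ≠ 0 ∧ invT a b ≠ 0 ∧ ∀ j, formulaDen a b j ≠ 0 := by
  have key := fun σ => (planarCrossRatio_comp_eq_iff hx hy hA hB σ).not.1 (h σ)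
  refine ⟨fun e => key (Equiv.swap 3 4) ?_, fun e => key 1 ?_, fun j e => ?_⟩
  · have h0 : Equiv.swap (3 : Fin 5) 4 0 = 0 := by decide
    have h1 : Equiv.swap (3 : Fin 5) 4 1 = 1 := by decide
    have h2 : Equiv.swap (3 : Fin 5) 4 2 = 2 := by decide
    simp [h0, h1, h2, bracket_eq, frameWith]
    simp only [invS] at e
    linear_combination e
  · simp [bracket_eq, frameWith]
    simp only [invT] at e
    linear_combination -e
  · fin_cases j
    · refine key (Equiv.swap 0 4) ?_
      have h1 : Equiv.swap (0 : Fin 5) 4 1 = 1 := by decide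
      have h2 : Equiv.swap (0 : Fin 5) 4 2 = 2 := by decide
      have h3 : Equiv.swap (0 : Fin 5) 4 3 = 3 := by decide
      simp [h1, h2, h3, bracket_eq, frameWith]
      simp [formulaDen] at e
      linear_combination -e
    · refine key (Equiv.swap 1 4) ?_
      have h0 : Equiv.swap (1 : Fin 5) 4 0 = 0 := by decide
      have h2 : Equiv.swap (1 : Fin 5) 4 2 = 2 := by decide
      have h3 : Equiv.swap (1 : Fin 5) 4 3 = 3 := by decide
      simp [h0, h2, h3, bracket_eq, frameWith]
      simp [formulaDen] at e
      linear_combination e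
    · refine key (Equiv.swap 2 4) ?_
      have h0 : Equiv.swap (2 : Fin 5) 4 0 = 0 := by decide
      have h1 : Equiv.swap (2 : Fin 5) 4 1 = 1 := by decide
      have h3 : Equiv.swap (2 : Fin 5) 4 3 = 3 := by decide
      simp [h0, h1, h3, bracket_eq, frameWith]
      simp [formulaDen] at e
      linear_combination e

/-- Otherwise `A` followed by the inverse of `B` would relate all five pairs. -/
lemma PairsInGeneralPosition.not_proportional (h : PairsInGeneralPosition x y)
    (hA : ∀ i, A.Sends (x i) (frameWith a i)) (hB : ∀ i, B.Sends (y i) (frameWith b i))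
    (k : ℂ) : b ≠ k • a := by
  intro e
  have hk : ∀ i, ∃ m : ℂ, frameWith b i = m • frameWith a i := by
    intro i
    fin_cases i
    exacts [⟨1, by simp [frameWith]⟩, ⟨1, by simp [frameWith]⟩, ⟨1, by simp [frameWith]⟩,
      ⟨1, by simp [frameWith]⟩, ⟨k, e⟩]
  have hmap : ∀ i, Homography.app (A.trans B.symm) (x i) = y i := by
    intro i
    obtain ⟨m, hm⟩ := hk i
    have h1 := (Homography.sends_iff (hA i).ne_zero).1 (hA i)
    have h2 := ((hB i).of_smul hm)
    rw [Homography.sends_iff (hA i).ne_zero, ← h1] at h2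
    apply B.app_injective
    rw [h2]
    induction x i using Projectivization.ind with
    | h v hv => simp [Homography.app_mk]
  have := h.homography (A.trans B.symm)
  simp [hmap, Set.ncard_univ] at this

/-- A sixth pair has to be the one given by the formula. -/
lemma IsSixthPair.sends_formula {p : Plane × Plane} (hp : IsSixthPair x y p)
    (h : PairsInGeneralPosition x y)
    (hA : ∀ i, A.Sends (x i) (frameWith a i)) (hB : ∀ i, B.Sends (y i) (frameWith b i)) :
    invT a b ≠ 0 ∧ A.Sends p.1 (formulaX a b) ∧ B.Sends p.2 (formulaY a b) := by
  have ha := h.left.genericVec hA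
  have hb := h.right.genericVec hB
  have hu := A.sends_rep p.1
  have hz := B.sends_rep p.2
  rw [isSixthPair_iff hA hB hu hz, dependent_frameWith_iff ha hb] at hp
  obtain ⟨hne, c, d, hcd⟩ := hp
  obtain ⟨-, hT, -, ⟨k, hk⟩, ⟨m, hm⟩⟩ := eq_formula_of_offDiag ha hb
    (h.not_proportional hA hB) hu.ne_zero hz.ne_zero hcd hne
  exact ⟨hT, hu.of_smul hk, hz.of_smul hm⟩

/-- The pair given by the formula is a sixth pair. -/
lemma isSixthPair_of_sends {p : Plane × Plane} (h : PairsInGeneralPosition x y)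
    (hA : ∀ i, A.Sends (x i) (frameWith a i)) (hB : ∀ i, B.Sends (y i) (frameWith b i))
    (hxy : CrossRatiosDiffer x y) (hu : A.Sends p.1 (formulaX a b))
    (hz : B.Sends p.2 (formulaY a b)) : IsSixthPair x y p := by
  have ha := h.left.genericVec hA
  have hb := h.right.genericVec hB
  obtain ⟨hS, hT, hD⟩ := hxy.invariants_ne_zero h.left h.right hA hB
  rw [isSixthPair_iff hA hB hu hz, dependent_frameWith_iff ha hb]
  refine ⟨formula_not_proportional ha hb hD hS hT, ?_⟩
  have hD' := mul_ne_zero (mul_ne_zero (hD 0) (hD 1)) (hD 2)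
  refine ⟨invT a b / (formulaDen a b 0 * formulaDen a b 1 * formulaDen a b 2),
    -invS a b / (formulaDen a b 0 * formulaDen a b 1 * formulaDen a b 2), fun j l hjl => ?_⟩
  rw [eq_div_of_mul_eq hD' (formulaX_mul_formulaY hD hjl)]
  ring

end normalized

/-! ### Permuting the pairs -/

lemma InGeneralPosition.comp {k : ℕ} {x : Fin k → Plane} (h : InGeneralPosition x)
    (σ : Equiv.Perm (Fin k)) : InGeneralPosition (x ∘ σ) where
  line L hL := by
    have := h.line L hL
    rwa [← Set.ncard_preimage_of_injective_subset_range σ.injective (by simp)] at this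
  conic Q hQ := by
    have := h.conic Q hQ
    rwa [← Set.ncard_preimage_of_injective_subset_range σ.injective (by simp)] at this

lemma PairsInGeneralPosition.comp {k : ℕ} {x y : Fin k → Plane}
    (h : PairsInGeneralPosition x y) (σ : Equiv.Perm (Fin k)) :
    PairsInGeneralPosition (x ∘ σ) (y ∘ σ) where
  left := h.left.comp σ
  right := h.right.comp σ
  homography H := by
    have := h.homography H
    rwa [← Set.ncard_preimage_of_injective_subset_range σ.injective (by simp)] at this

lemma IsSixthPair.comp {x y : Fin 5 → Plane} {p : Plane × Plane} (h : IsSixthPair x y p)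
    (σ : Equiv.Perm (Fin 5)) : IsSixthPair (x ∘ σ) (y ∘ σ) p := by
  -- The identity homography makes the chosen representatives the coordinates, so that dependence
  -- can be tested on them.
  have hv := fun i => Homography.sends_rep (LinearEquiv.refl ℂ Vec) (x i)
  have hw := fun i => Homography.sends_rep (LinearEquiv.refl ℂ Vec) (y i)
  have hu := Homography.sends_rep (LinearEquiv.refl ℂ Vec) p.1
  have hz := Homography.sends_rep (LinearEquiv.refl ℂ Vec) p.2
  rw [isSixthPair_iff hv hw hu hz] at h
  rw [isSixthPair_iff (x := x ∘ σ) (y := y ∘ σ) (fun i => hv (σ i)) (fun i => hw (σ i)) hu hz]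
  obtain ⟨hne, g, hg, i, hi⟩ := h
  refine ⟨fun i => hne (σ i),
    (Fin.snoc (fun i => g (Fin.castSucc (σ i))) (g (Fin.last 5)) : Fin 6 → ℂ), ?_, ?_⟩
  · rw [Fin.sum_univ_castSucc] at hg ⊢
    simp only [Fin.snoc_castSucc, Fin.snoc_last] at hg ⊢
    rw [← hg]
    congr 1
    exact Equiv.sum_comp σ fun i => g i.castSucc • Matrix.vecMulVec
      ((LinearEquiv.refl ℂ Vec) (x i).rep) ((LinearEquiv.refl ℂ Vec) (y i).rep)
  · induction i using Fin.lastCases with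
    | last => exact ⟨Fin.last 5, by simpa only [Fin.snoc_last] using hi⟩
    | cast i => exact ⟨(σ.symm i).castSucc, by simpa only [Fin.snoc_castSucc,
        Equiv.apply_symm_apply] using hi⟩

/-! ### Explicit frames -/

section explicit

variable {R : Type*} [CommRing R]

/-- The bracket over a commutative ring. -/
def ringBracket (u v w : Fin 3 → R) : R :=
  u 0 * v 1 * w 2 - u 0 * v 2 * w 1 - u 1 * v 0 * w 2 + u 1 * v 2 * w 0 +
    u 2 * v 0 * w 1 - u 2 * v 1 * w 0

/-- The matrix that sends the standard frame to the first four of five vectors, up to scalars. -/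
def frameMatrix (v : Fin 5 → Fin 3 → R) : Matrix (Fin 3) (Fin 3) R :=
  Matrix.of fun j => ![ringBracket (v 3) (v 1) (v 2) * v 0 j,
    ringBracket (v 0) (v 3) (v 2) * v 1 j, ringBracket (v 0) (v 1) (v 3) * v 2 j]

/-- The coordinates of the fifth vector in the frame of the first four. -/
def fifthCoord (v : Fin 5 → Fin 3 → R) : Fin 3 → R :=
  ![ringBracket (v 4) (v 1) (v 2) * ringBracket (v 0) (v 3) (v 2) * ringBracket (v 0) (v 1) (v 3),
    ringBracket (v 0) (v 4) (v 2) * ringBracket (v 3) (v 1) (v 2) * ringBracket (v 0) (v 1) (v 3),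
    ringBracket (v 0) (v 1) (v 4) * ringBracket (v 3) (v 1) (v 2) * ringBracket (v 0) (v 3) (v 2)]

/-- The formula for the sixth pair, with its denominators cleared. The vector `c` is the
argument that enters the numerators. -/
def clearedFormula (a b c : Fin 3 → R) : Fin 3 → R :=
  ![(c 2 - c 1) * ((b 2 * a 0 - a 2 * b 0) * (b 0 * a 1 - a 0 * b 1)),
    (c 2 - c 0) * ((b 2 * a 1 - a 2 * b 1) * (b 0 * a 1 - a 0 * b 1)),
    (c 0 - c 1) * ((b 2 * a 1 - a 2 * b 1) * (b 2 * a 0 - a 2 * b 0))]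

/-- Polynomial coordinates of the first point of the sixth pair. -/
def sixthX (v w : Fin 5 → Fin 3 → R) : Fin 3 → R :=
  frameMatrix v *ᵥ clearedFormula (fifthCoord v) (fifthCoord w) (fifthCoord w)

/-- Polynomial coordinates of the second point of the sixth pair. -/
def sixthY (v w : Fin 5 → Fin 3 → R) : Fin 3 → R :=
  frameMatrix w *ᵥ clearedFormula (fifthCoord v) (fifthCoord w) (fifthCoord v)

variable {S : Type*} [CommRing S] (f : R →+* S)

lemma map_ringBracket (u v w : Fin 3 → R) :
    f (ringBracket u v w) = ringBracket (f ∘ u) (f ∘ v) (f ∘ w) := by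
  simp [ringBracket]

lemma map_fifthCoord (v : Fin 5 → Fin 3 → R) :
    f ∘ fifthCoord v = fifthCoord fun i => f ∘ v i := by
  ext j
  fin_cases j <;> simp [fifthCoord, map_ringBracket]

lemma map_clearedFormula (a b c : Fin 3 → R) :
    f ∘ clearedFormula a b c = clearedFormula (f ∘ a) (f ∘ b) (f ∘ c) := by
  ext j
  fin_cases j <;> simp [clearedFormula]

lemma map_frameMatrix (v : Fin 5 → Fin 3 → R) :
    (frameMatrix v).map f = frameMatrix fun i => f ∘ v i := by
  ext i j
  fin_cases j <;> simp [frameMatrix, map_ringBracket]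

lemma map_sixthX (v w : Fin 5 → Fin 3 → R) :
    f ∘ sixthX v w = sixthX (fun i => f ∘ v i) (fun i => f ∘ w i) := by
  ext j
  simp only [sixthX, Function.comp_apply, RingHom.map_mulVec, map_frameMatrix,
    map_clearedFormula, map_fifthCoord]

lemma map_sixthY (v w : Fin 5 → Fin 3 → R) :
    f ∘ sixthY v w = sixthY (fun i => f ∘ v i) (fun i => f ∘ w i) := by
  ext j
  simp only [sixthY, Function.comp_apply, RingHom.map_mulVec, map_frameMatrix,
    map_clearedFormula, map_fifthCoord]

/-- The columns are `v 0`, `v 1`, `v 2`, each scaled by one bracket. -/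
lemma det_frameMatrix (v : Fin 5 → Fin 3 → R) :
    (frameMatrix v).det = ringBracket (v 3) (v 1) (v 2) * ringBracket (v 0) (v 3) (v 2) *
      ringBracket (v 0) (v 1) (v 3) * ringBracket (v 0) (v 1) (v 2) := by
  rw [Matrix.det_fin_three]
  simp only [frameMatrix, Matrix.of_apply, Matrix.cons_val]
  generalize ringBracket (v 3) (v 1) (v 2) = r
  generalize ringBracket (v 0) (v 3) (v 2) = s
  generalize ringBracket (v 0) (v 1) (v 3) = t
  rw [ringBracket]
  ring

end explicit

lemma ringBracket_eq_bracket (u v w : Vec) : ringBracket u v w = bracket u v w :=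
  (bracket_eq u v w).symm

/-- Cramer's rule: `[412] v₀ + [042] v₁ + [014] v₂ = [012] v₄`, and likewise with `v₃` for `v₄`. The
latter explains the column weights; dividing by them and clearing denominators gives `fifthCoord`.
-/
lemma frameMatrix_mulVec_frameWith (v : Fin 5 → Vec) (i : Fin 5) :
    ∃ s : ℂ, frameMatrix v *ᵥ frameWith (fifthCoord v) i = s • v i := by
  fin_cases i
  · refine ⟨ringBracket (v 3) (v 1) (v 2), ?_⟩
    ext j; simp [frameMatrix, frameWith, Matrix.mulVec, dotProduct, Fin.sum_univ_three]
  · refine ⟨ringBracket (v 0) (v 3) (v 2), ?_⟩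
    ext j; simp [frameMatrix, frameWith, Matrix.mulVec, dotProduct, Fin.sum_univ_three]
  · refine ⟨ringBracket (v 0) (v 1) (v 3), ?_⟩
    ext j; simp [frameMatrix, frameWith, Matrix.mulVec, dotProduct, Fin.sum_univ_three]
  · refine ⟨ringBracket (v 0) (v 1) (v 2), ?_⟩
    ext j; simp [frameMatrix, frameWith, Matrix.mulVec, dotProduct, Fin.sum_univ_three]
    fin_cases j <;> simp [ringBracket] <;> ring
  · refine ⟨ringBracket (v 3) (v 1) (v 2) * ringBracket (v 0) (v 3) (v 2) *
      ringBracket (v 0) (v 1) (v 3) * ringBracket (v 0) (v 1) (v 2), ?_⟩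
    ext j
    simp [frameMatrix, frameWith, fifthCoord, Matrix.mulVec, dotProduct, Fin.sum_univ_three]
    have e : ringBracket (v 4) (v 1) (v 2) * v 0 j + ringBracket (v 0) (v 4) (v 2) * v 1 j +
        ringBracket (v 0) (v 1) (v 4) * v 2 j = ringBracket (v 0) (v 1) (v 2) * v 4 j := by
      fin_cases j <;> simp [ringBracket] <;> ring
    linear_combination ringBracket (v 3) (v 1) (v 2) * ringBracket (v 0) (v 3) (v 2) *
      ringBracket (v 0) (v 1) (v 3) * e

/-- Five points in general position have frame coordinates, by an explicit matrix. -/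
lemma InGeneralPosition.exists_explicit_frame {v : Fin 5 → Vec} (hv : ∀ i, v i ≠ 0)
    (h : InGeneralPosition fun i => Projectivization.mk ℂ (v i) (hv i)) :
    ∃ F : Homography, (∀ u, F u = frameMatrix v *ᵥ u) ∧
      ∀ i, Homography.Sends F.symm (Projectivization.mk ℂ (v i) (hv i))
        (frameWith (fifthCoord v) i) := by
  have hs : ∀ i, Homography.Sends (LinearEquiv.refl ℂ Vec) (Projectivization.mk ℂ (v i) (hv i))
      (v i) := fun i => (Homography.sends_iff (hv i)).2 rfl
  have k := fun i j k => h.bracket_ne_zero hs (i := i) (j := j) (k := k)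
  have hdet : (frameMatrix v).det ≠ 0 := by
    simp only [det_frameMatrix, ringBracket_eq_bracket]
    refine mul_ne_zero (mul_ne_zero (mul_ne_zero ?_ ?_) ?_) ?_ <;>
      exact k _ _ _ (by decide) (by decide) (by decide)
  let F : Homography := (frameMatrix v).toLinearEquiv' (Matrix.invertibleOfIsUnitDet _ hdet.isUnit)
  have hF : ∀ u, F u = frameMatrix v *ᵥ u := fun u => rfl
  refine ⟨F, hF, fun i => ?_⟩
  obtain ⟨s, e⟩ := frameMatrix_mulVec_frameWith v i
  refine Homography.symm_sends_mk (hv i) s ?_ ((hF _).trans e)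
  fin_cases i
  · exact frameVec_ne_zero 0
  · exact frameVec_ne_zero 1
  · exact frameVec_ne_zero 2
  · exact frameVec_ne_zero 3
  · intro e0
    have := congrFun e0 0
    simp only [frameWith, fifthCoord, ringBracket_eq_bracket] at this
    refine mul_ne_zero (mul_ne_zero ?_ ?_) ?_ this <;>
      exact k _ _ _ (by decide) (by decide) (by decide)

lemma InGeneralPosition.exists_frame {x : Fin 5 → Plane} (h : InGeneralPosition x) :
    ∃ (A : Homography) (a : Vec), ∀ i, A.Sends (x i) (frameWith a i) := by
  obtain ⟨F, -, hF⟩ := InGeneralPosition.exists_explicit_frame (fun i => (x i).rep_nonzero)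
    (by simpa only [Projectivization.mk_rep] using h)
  simp only [Projectivization.mk_rep] at hF
  exact ⟨F.symm, _, hF⟩

lemma clearedFormula_eq_formulaX {a b : Vec} (hD : ∀ j, formulaDen a b j ≠ 0) :
    clearedFormula a b b =
      (formulaDen a b 0 * formulaDen a b 1 * formulaDen a b 2) • formulaX a b := by
  have D0 := hD 0
  have D1 := hD 1
  have D2 := hD 2
  have e : clearedFormula a b b =
      ![(b 2 - b 1) * (formulaDen a b 1 * formulaDen a b 2),
        (b 2 - b 0) * (formulaDen a b 0 * formulaDen a b 2),
        (b 0 - b 1) * (formulaDen a b 0 * formulaDen a b 1)] := rfl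
  rw [e]
  ext j
  fin_cases j <;> simp only [formulaX, Pi.smul_apply, smul_eq_mul, Fin.zero_eta, Fin.mk_one,
    Fin.reduceFinMk, Matrix.cons_val] <;> field_simp

lemma clearedFormula_eq_formulaY {a b : Vec} (hD : ∀ j, formulaDen a b j ≠ 0) :
    clearedFormula a b a =
      (formulaDen a b 0 * formulaDen a b 1 * formulaDen a b 2) • formulaY a b := by
  have D0 := hD 0
  have D1 := hD 1
  have D2 := hD 2
  have e : clearedFormula a b a =
      ![(a 2 - a 1) * (formulaDen a b 1 * formulaDen a b 2),
        (a 2 - a 0) * (formulaDen a b 0 * formulaDen a b 2),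
        (a 0 - a 1) * (formulaDen a b 0 * formulaDen a b 1)] := rfl
  rw [e]
  ext j
  fin_cases j <;> simp only [formulaY, Pi.smul_apply, smul_eq_mul, Fin.zero_eta, Fin.mk_one,
    Fin.reduceFinMk, Matrix.cons_val] <;> field_simp

/-! ### Existence, uniqueness and necessity of (∗) -/

/-- After reordering by `σ`, the cross-ratio in question is the one measured by `invT`, which a
sixth pair forces to be nonzero. -/
lemma IsSixthPair.crossRatiosDiffer {x y : Fin 5 → Plane} {p : Plane × Plane}
    (hp : IsSixthPair x y p) (h : PairsInGeneralPosition x y) : CrossRatiosDiffer x y := by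
  intro σ e
  obtain ⟨A, a, hA⟩ := (h.left.comp σ).exists_frame
  obtain ⟨B, b, hB⟩ := (h.right.comp σ).exists_frame
  refine ((hp.comp σ).sends_formula (h.comp σ) hA hB).1 ?_
  have := (planarCrossRatio_comp_eq_iff (h.left.comp σ) (h.right.comp σ) hA hB 1).1 e
  simp [bracket_eq, frameWith] at this
  simp only [invT]
  linear_combination -this

theorem existsUnique_isSixthPair {x y : Fin 5 → Plane} (h : PairsInGeneralPosition x y)
    (hxy : CrossRatiosDiffer x y) : ∃! p : Plane × Plane, IsSixthPair x y p := by
  obtain ⟨A, a, hA⟩ := h.left.exists_frame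
  obtain ⟨B, b, hB⟩ := h.right.exists_frame
  obtain ⟨-, -, hD⟩ := hxy.invariants_ne_zero h.left h.right hA hB
  obtain ⟨p, hp⟩ := A.exists_sends fun e =>
    formulaX_apply_ne_zero (h.right.genericVec hB) hD 0 (congrFun e 0)
  obtain ⟨q, hq⟩ := B.exists_sends fun e =>
    formulaY_apply_ne_zero (h.left.genericVec hA) hD 0 (congrFun e 0)
  refine ⟨(p, q), isSixthPair_of_sends h hA hB hxy hp hq, fun r hr => ?_⟩
  obtain ⟨-, h1, h2⟩ := hr.sends_formula h hA hB
  exact Prod.ext (h1.unique hp) (h2.unique hq)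

/-! ### Polynomial coordinates of the sixth pair -/

/-- The coordinates of the first vectors, as polynomials. -/
def varX (i : Fin 5) (j : Fin 3) : CoordPoly := MvPolynomial.X (Sum.inl (i, j))

/-- The coordinates of the second vectors, as polynomials. -/
def varY (i : Fin 5) (j : Fin 3) : CoordPoly := MvPolynomial.X (Sum.inr (i, j))

/-- The construction makes sense over any commutative ring and commutes with ring homomorphisms,
here evaluation of polynomials. -/
lemma evalAt_sixthX (v w : Fin 5 → Vec) :
    (fun j => CoordPoly.evalAt (sixthX varX varY j) v w) = sixthX v w := by
  have := map_sixthX (MvPolynomial.eval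
    (Sum.elim (fun ij => v ij.1 ij.2) (fun ij => w ij.1 ij.2))) varX varY
  refine this.trans ?_
  congr 1 <;> ext i j <;> simp [varX, varY]

lemma evalAt_sixthY (v w : Fin 5 → Vec) :
    (fun j => CoordPoly.evalAt (sixthY varX varY j) v w) = sixthY v w := by
  have := map_sixthY (MvPolynomial.eval
    (Sum.elim (fun ij => v ij.1 ij.2) (fun ij => w ij.1 ij.2))) varX varY
  refine this.trans ?_
  congr 1 <;> ext i j <;> simp [varX, varY]

lemma isSixthPair_sixth (v w : Fin 5 → Vec) (hv : ∀ i, v i ≠ 0) (hw : ∀ i, w i ≠ 0)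
    (h : PairsInGeneralPosition (fun i => Projectivization.mk ℂ (v i) (hv i))
      (fun i => Projectivization.mk ℂ (w i) (hw i)))
    (hxy : CrossRatiosDiffer (fun i => Projectivization.mk ℂ (v i) (hv i))
      (fun i => Projectivization.mk ℂ (w i) (hw i))) :
    ∃ (hP : sixthX v w ≠ 0) (hQ : sixthY v w ≠ 0),
      IsSixthPair (fun i => Projectivization.mk ℂ (v i) (hv i))
        (fun i => Projectivization.mk ℂ (w i) (hw i))
        (Projectivization.mk ℂ _ hP, Projectivization.mk ℂ _ hQ) := by
  obtain ⟨F, hF, hA⟩ := h.left.exists_explicit_frame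
  obtain ⟨G, hG, hB⟩ := h.right.exists_explicit_frame
  obtain ⟨-, -, hD⟩ := hxy.invariants_ne_zero h.left h.right hA hB
  have hX : formulaX (fifthCoord v) (fifthCoord w) ≠ 0 := fun e =>
    formulaX_apply_ne_zero (h.right.genericVec hB) hD 0 (congrFun e 0)
  have hY : formulaY (fifthCoord v) (fifthCoord w) ≠ 0 := fun e =>
    formulaY_apply_ne_zero (h.left.genericVec hA) hD 0 (congrFun e 0)
  have hk := mul_ne_zero (mul_ne_zero (hD 0) (hD 1)) (hD 2)
  -- The factor by which the cleared formula differs from the fractional one, the same for both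
  -- points.
  obtain ⟨k, hk'⟩ : ∃ k, k = formulaDen (fifthCoord v) (fifthCoord w) 0 *
      formulaDen (fifthCoord v) (fifthCoord w) 1 * formulaDen (fifthCoord v) (fifthCoord w) 2 :=
    ⟨_, rfl⟩
  rw [← hk'] at hk
  have eX : sixthX v w = k • F (formulaX (fifthCoord v) (fifthCoord w)) := by
    rw [sixthX, clearedFormula_eq_formulaX hD, ← hk', Matrix.mulVec_smul, hF]
  have eY : sixthY v w = k • G (formulaY (fifthCoord v) (fifthCoord w)) := by
    rw [sixthY, clearedFormula_eq_formulaY hD, ← hk', Matrix.mulVec_smul, hG]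
  refine ⟨eX ▸ smul_ne_zero hk (F.map_ne_zero_iff.2 hX),
    eY ▸ smul_ne_zero hk (G.map_ne_zero_iff.2 hY), ?_⟩
  refine isSixthPair_of_sends h hA hB hxy (Homography.symm_sends_mk _ k⁻¹ hX ?_)
    (Homography.symm_sends_mk _ k⁻¹ hY ?_)
  · rw [eX, inv_smul_smul₀ hk]
  · rw [eY, inv_smul_smul₀ hk]

lemma FixesFrame.sends {H : Homography} {x : Fin 5 → Plane} {a : Vec} (h : FixesFrame H x)
    (ha : a ≠ 0) (h4 : H.app (x 4) = Projectivization.mk ℂ a ha) (i : Fin 5) :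
    H.Sends (x i) (frameWith a i) := by
  fin_cases i
  · exact (Homography.sends_iff (frameVec_ne_zero 0)).2 (h 0)
  · exact (Homography.sends_iff (frameVec_ne_zero 1)).2 (h 1)
  · exact (Homography.sends_iff (frameVec_ne_zero 2)).2 (h 2)
  · exact (Homography.sends_iff (frameVec_ne_zero 3)).2 (h 3)
  · exact (Homography.sends_iff ha).2 h4

lemma InGeneralPosition.exists_fixesFrame {x : Fin 5 → Plane} (h : InGeneralPosition x) :
    ∃ A : Homography, FixesFrame A x := by
  obtain ⟨A, a, hA⟩ := h.exists_frame
  refine ⟨A, fun i => ?_⟩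
  fin_cases i
  · exact (Homography.sends_iff (frameVec_ne_zero 0)).1 (hA 0)
  · exact (Homography.sends_iff (frameVec_ne_zero 1)).1 (hA 1)
  · exact (Homography.sends_iff (frameVec_ne_zero 2)).1 (hA 2)
  · exact (Homography.sends_iff (frameVec_ne_zero 3)).1 (hA 3)

end SixthPoint

end

open SixthPoint in
theorem lemma6p2 :
    -- existence and uniqueness of the sixth pair
    (∀ x y : Fin 5 → Plane, PairsInGeneralPosition x y →
      (CrossRatiosDiffer x y → ∃! p : Plane × Plane, IsSixthPair x y p) ∧
      (¬ CrossRatiosDiffer x y → ¬ ∃ p : Plane × Plane, IsSixthPair x y p)) ∧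
    -- the sixth pair is a rational function of the five pairs
    (∃ P Q : Fin 3 → CoordPoly, ∀ (v w : Fin 5 → Vec) (hv : ∀ i, v i ≠ 0) (hw : ∀ i, w i ≠ 0),
      PairsInGeneralPosition (fun i => Projectivization.mk ℂ (v i) (hv i))
        (fun i => Projectivization.mk ℂ (w i) (hw i)) →
      CrossRatiosDiffer (fun i => Projectivization.mk ℂ (v i) (hv i))
        (fun i => Projectivization.mk ℂ (w i) (hw i)) →
      ∃ (hP : (fun j => (P j).evalAt v w) ≠ 0) (hQ : (fun j => (Q j).evalAt v w) ≠ 0),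
        IsSixthPair (fun i => Projectivization.mk ℂ (v i) (hv i))
          (fun i => Projectivization.mk ℂ (w i) (hw i))
          (Projectivization.mk ℂ _ hP, Projectivization.mk ℂ _ hQ)) ∧
    -- the formula after the first four points have been fixed by homographies
    (∀ x y : Fin 5 → Plane, PairsInGeneralPosition x y → CrossRatiosDiffer x y →
      (∃ A B : Homography, FixesFrame A x ∧ FixesFrame B y) ∧
      ∀ A B : Homography, FixesFrame A x → FixesFrame B y →
        ∀ (a b : Vec) (ha : a ≠ 0) (hb : b ≠ 0),
          A.app (x 4) = Projectivization.mk ℂ a ha →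
          B.app (y 4) = Projectivization.mk ℂ b hb →
          (∀ j, formulaDen a b j ≠ 0) ∧
          ∃ (hX : formulaX a b ≠ 0) (hY : formulaY a b ≠ 0),
            ∀ p : Plane × Plane, IsSixthPair x y p →
              A.app p.1 = Projectivization.mk ℂ (formulaX a b) hX ∧
              B.app p.2 = Projectivization.mk ℂ (formulaY a b) hY) := by 
  refine ⟨fun x y h => ⟨existsUnique_isSixthPair h, fun hn ⟨p, hp⟩ => hn (hp.crossRatiosDiffer h)⟩,
    ⟨sixthX varX varY, sixthY varX varY, fun v w hv hw h hxy => ?_⟩, fun x y h hxy =>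
    ⟨⟨h.left.exists_fixesFrame.choose, h.right.exists_fixesFrame.choose,
      h.left.exists_fixesFrame.choose_spec, h.right.exists_fixesFrame.choose_spec⟩,
      fun A B hA hB a b ha hb h4 h4' => ?_⟩⟩
  · simp only [evalAt_sixthX, evalAt_sixthY]
    exact isSixthPair_sixth v w hv hw h hxy
  · have sA := hA.sends ha h4
    have sB := hB.sends hb h4'
    obtain ⟨-, -, hD⟩ := hxy.invariants_ne_zero h.left h.right sA sB
    have hX : formulaX a b ≠ 0 := fun e =>
      formulaX_apply_ne_zero (h.right.genericVec sB) hD 0 (congrFun e 0)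
    have hY : formulaY a b ≠ 0 := fun e =>
      formulaY_apply_ne_zero (h.left.genericVec sA) hD 0 (congrFun e 0)
    refine ⟨hD, hX, hY, fun p hp => ?_⟩
    obtain ⟨-, h1, h2⟩ := hp.sends_formula h sA sB
    exact ⟨(Homography.sends_iff hX).1 h1, (Homography.sends_iff hY).1 h2⟩
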